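/- Let $s\ge 1$ be an integer. For positive integers $w\le n$, a multiplicity vector is $\boldsymbol r=(r_1,\dots,r_w)$ with integers $r_i\ge 1$ and $r_1+\cdots+r_w=n$; it need not be regular, i.e. the $r_i$ need not be equal. Let $S_n^{\boldsymbol r}$ be the set of multi-permutations, i.e. words of length $n$ over $\{1,\dots,w\}$ in which each symbol $i$ appears exactly $r_i$ times. A burst stable deletion of length $t$ ($1\le t\le n$) turns $(\sigma_1,\dots,\sigma_n)$ into $(\sigma_1,\dots,\sigma_{i-1},\sigma_{i+t},\dots,\sigma_n)$ for some $1\le i\le n-t+1$. A code $\mathcal C\subseteq S_n^{\boldsymbol r}$ is an $^{\le}s$-BSD multi-permutation code if no word can be obtained from two distinct codewords by burst stable deletions of length at most $s$. The redundancy of a nonempty $\mathcal C$ is $\log_2|S_n^{\boldsymbol r}|-\log_2|\mathcal C|$. Then for every multiplicity vector $\boldsymbol r$ with $n\ge 2$ there exists a nonempty $^{\le}s$-BSD multi-permutation code in $S_n^{\boldsymbol r}$ with redundancy at most $$\log_2 n+(3s-2)\log_2\log_2 n+K,$$ where $K$ is a constant that depends only on $s$ and on the largest multiplicity $r_{\max}=\max_{1\le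 i\le w} r_i$ (and not on $n$, $w$ or the rest of $\boldsymbol r$). -/

import Mathlib

/-- `r = (r_1, …, r_w)` is a multiplicity vector for length `n`: all entries are positive and they
sum to `n`. -/
def IsMultiplicityVector (n : ℕ) {w : ℕ} (r : Fin w → ℕ) : Prop :=
  (∀ a, 1 ≤ r a) ∧ ∑ a, r a = n

/-- The set `S_n^r` of multi-permutations: the words of length `n` over `w` symbols in which each
symbol `a` appears exactly `r a` times. -/
def multiPerms (n : ℕ) {w : ℕ} (r : Fin w → ℕ) : Finset (Fin n → Fin w) :=
  Finset.univ.filter fun σ => ∀ a, (Finset.univ.filter fun i => σ i = a).card = r a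

/-- The words that result from `σ` by a burst stable deletion of length exactly `t`, i.e. by
deleting `t` consecutive entries, the first `i` entries and those after the burst being kept. -/
def burstBall (t : ℕ) {n : ℕ} {α : Type*} (σ : Fin n → α) : Set (List α) :=
  {y | ∃ i, i + t ≤ n ∧ y = (List.ofFn σ).take i ++ (List.ofFn σ).drop (i + t)}

/-- The words that result from `σ` by a burst stable deletion of length at most `s`. -/
def burstBallLE (s : ℕ) {n : ℕ} {α : Type*} (σ : Fin n → α) : Set (List α) :=
  {y | ∃ t, 1 ≤ t ∧ t ≤ s ∧ y ∈ burstBall t σ}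

/-- `C` is an `≤s`-BSD multi-permutation code in `S_n^r`: it consists of multi-permutations and it
can correct a burst stable deletion of length at most `s`, i.e. no word results from two distinct
codewords. -/
def IsBSDCodeLE (s n : ℕ) {w : ℕ} (r : Fin w → ℕ) (C : Finset (Fin n → Fin w)) : Prop :=
  C ⊆ multiPerms n r ∧
    ∀ σ₁ ∈ C, ∀ σ₂ ∈ C, σ₁ ≠ σ₂ → Disjoint (burstBallLE s σ₁) (burstBallLE s σ₂)

/-- The redundancy `log₂ |S_n^r| - log₂ |C|` of a (nonempty) code `C` in `S_n^r`. -/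
noncomputable def redundancy (n : ℕ) {w : ℕ} (r : Fin w → ℕ) (C : Finset (Fin n → Fin w)) : ℝ :=
  Real.logb 2 ((multiPerms n r).card : ℝ) - Real.logb 2 (C.card : ℝ)

/-! If two words of `multiPerms n r` share a word after short bursts, the deleted blocks are
permutations of each other, so one word arises from the other by moving a block `B` of at most `s`
entries across a block `M` and permuting its entries. By pigeonhole it suffices to find a label with
few values that separates such pairs on at least half of the words (`exists_code_of_label`); the
redundancy is then at most the logarithm of twice the number of labels.

For `s = 1` the label is a Varshamov-Tenengolts sum of the positions of the ascents modulo `n + 2`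
(`eq_of_ascentSum_modEq`), which costs `log n + O(1)`.

For `s ≥ 2` one has `3 * s - 2 ≥ 4`, so `log n + 4 log log n + O(1)` is enough. Mark a random set of
symbols. With bounded multiplicities, an exponential moment bound and a union bound show that a
suitable marking gives, in at least half of the words, every block of length at least `L = O(log n)`
some marked entries, but not too many (`exists_two_mul_card_not_evenlyMarked_le`). The sum of the
marked positions modulo `O(n)` then forces `M` to be shorter than `L`
(`length_lt_of_markSum_modEq`). What remains is confined to a window of length `O(log n)`. A greedy
colouring separates related windows with `O((log n) ^ 2)` colours, and two sums of window colours
recover the change (`eq_of_windowSum_modEq`), each costing `2 log log n + O(1)`. -/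

/-! ### The burst relation and codes from labels -/

/-- Two lists are burst related when deleting a block of length between `1` and `s` from each of
them gives the same list, the two blocks being permutations of each other. -/
def BurstRelated {α : Type*} (s : ℕ) (u v : List α) : Prop :=
  ∃ p₁ x₁ q₁ p₂ x₂ q₂ : List α, u = p₁ ++ x₁ ++ q₁ ∧ v = p₂ ++ x₂ ++ q₂ ∧
    p₁ ++ q₁ = p₂ ++ q₂ ∧ 1 ≤ x₁.length ∧ x₁.length ≤ s ∧ x₁.Perm x₂

theorem BurstRelated.symm {α : Type*} {s : ℕ} {u v : List α} (h : BurstRelated s u v) :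
    BurstRelated s v u := by
  obtain ⟨p₁, x₁, q₁, p₂, x₂, q₂, h1, h2, h3, h4, h5, h6⟩ := h
  exact ⟨p₂, x₂, q₂, p₁, x₁, q₁, h2, h1, h3.symm, h6.length_eq ▸ h4, h6.length_eq ▸ h5, h6.symm⟩

/-- Up to symmetry, burst related lists have the form `A B M C` and `A M B' C`. -/
theorem BurstRelated.cases {α : Type*} {s : ℕ} {u v : List α} (h : BurstRelated s u v) :
    ∃ A B M B' C : List α, 1 ≤ B.length ∧ B.length ≤ s ∧ B.Perm B' ∧
      ((u = A ++ (B ++ M) ++ C ∧ v = A ++ (M ++ B') ++ C) ∨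
        (v = A ++ (B ++ M) ++ C ∧ u = A ++ (M ++ B') ++ C)) := by
  obtain ⟨p₁, x₁, q₁, p₂, x₂, q₂, h1, h2, h3, h4, h5, h6⟩ := h
  rcases List.append_eq_append_iff.1 h3 with ⟨M, rfl, rfl⟩ | ⟨M, rfl, rfl⟩
  · exact ⟨p₁, x₁, M, x₂, q₂, h4, h5, h6, Or.inl ⟨by simp [h1], by simp [h2]⟩⟩
  · exact ⟨p₂, x₂, M, x₁, q₁, h6.length_eq ▸ h4, h6.length_eq ▸ h5, h6.symm,
      Or.inr ⟨by simp [h2], by simp [h1]⟩⟩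

theorem burstRelated_of_perm {α : Type*} {s : ℕ} {B B' : List α} (A M C : List α)
    (h1 : 1 ≤ B.length) (h2 : B.length ≤ s) (h : B.Perm B') :
    BurstRelated s (A ++ (B ++ M) ++ C) (A ++ (M ++ B') ++ C) :=
  ⟨A, B, M ++ C, A ++ M, B', C, by simp, by simp, by simp, h1, h2, h⟩

theorem count_ofFn_eq_card {n : ℕ} {α : Type*} [DecidableEq α] (σ : Fin n → α) (a : α) :
    (List.ofFn σ).count a = (Finset.univ.filter fun i => σ i = a).card := by
  rw [List.ofFn_eq_map, List.count_eq_countP, List.countP_map, Finset.card_def,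
    List.countP_eq_length_filter]
  have : (Finset.univ.filter fun i => σ i = a).val =
      ((List.finRange n).filter fun i => decide (σ i = a) : List (Fin n)) := rfl
  rw [this, Multiset.coe_card]
  congr 1

theorem count_ofFn_of_mem_multiPerms {n w : ℕ} {r : Fin w → ℕ} {σ : Fin n → Fin w}
    (h : σ ∈ multiPerms n r) (a : Fin w) : (List.ofFn σ).count a = r a := by
  rw [count_ofFn_eq_card]
  exact (Finset.mem_filter.1 h).2 a

theorem multiPerms_nonempty {n w : ℕ} {r : Fin w → ℕ} (h : IsMultiplicityVector n r) :
    (multiPerms n r).Nonempty := by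
  obtain ⟨-, rfl⟩ := h
  -- The witness lists the symbols in order, each repeated `r a` times.
  refine ⟨fun i => (finSigmaFinEquiv.symm i).1, Finset.mem_filter.2 ⟨Finset.mem_univ _, fun a => ?_⟩⟩
  have e : (Finset.univ.filter fun i : Fin (∑ a, r a) => (finSigmaFinEquiv.symm i).1 = a) =
      (Finset.univ : Finset (Fin (r a))).image fun j => finSigmaFinEquiv ⟨a, j⟩ := by
    ext i
    simp only [Finset.mem_filter, Finset.mem_univ, true_and, Finset.mem_image]
    constructor
    · rintro rfl
      exact ⟨(finSigmaFinEquiv.symm i).2, by simp⟩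
    · rintro ⟨j, rfl⟩
      simp
  rw [e, Finset.card_image_of_injective _ fun i j hij => ?_, Finset.card_univ, Fintype.card_fin]
  simpa using hij

/-- Both words have length `n`, so a common result forces equal burst lengths; both have the
multiplicities `r`, so the deleted blocks have equal counts. -/
theorem burstRelated_of_not_disjoint {s n w : ℕ} {r : Fin w → ℕ} {σ τ : Fin n → Fin w}
    (hσ : σ ∈ multiPerms n r) (hτ : τ ∈ multiPerms n r)
    (h : ¬ Disjoint (burstBallLE s σ) (burstBallLE s τ)) :
    BurstRelated s (List.ofFn σ) (List.ofFn τ) := by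
  obtain ⟨y, ⟨t, ht1, hts, i, hi, hy⟩, ⟨t', ht1', hts', j, hj, hy'⟩⟩ := Set.not_disjoint_iff.1 h
  have hl := congrArg List.length (hy.symm.trans hy')
  simp only [List.length_append, List.length_take, List.length_drop, List.length_ofFn] at hl
  obtain rfl : t = t' := by omega
  have split : ∀ (l : List (Fin w)) (k : ℕ),
      l = l.take k ++ (l.drop k).take t ++ l.drop (k + t) := by
    intro l k
    rw [List.append_assoc, ← List.drop_drop, List.take_append_drop, List.take_append_drop]
  refine ⟨_, _, _, _, _, _, split _ i, split _ j, hy.symm.trans hy', ?_, ?_, ?_⟩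
  · simp; omega
  · simp; omega
  · rw [List.perm_iff_count]
    intro a
    have h1 := congrArg (List.count a) (split (List.ofFn σ) i)
    have h2 := congrArg (List.count a) (split (List.ofFn τ) j)
    have h3 := congrArg (List.count a) (hy.symm.trans hy')
    rw [count_ofFn_of_mem_multiPerms hσ] at h1
    rw [count_ofFn_of_mem_multiPerms hτ] at h2
    simp only [List.count_append] at h1 h2 h3
    omega

/-- A labelling that separates burst related words on a dense set gives a code. -/
theorem exists_code_of_label {s n w : ℕ} {r : Fin w → ℕ} {β : Type*} [DecidableEq β]
    (hr : IsMultiplicityVector n r) (G : Finset (Fin n → Fin w)) (hG : G ⊆ multiPerms n r)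
    (hcard : (multiPerms n r).card ≤ 2 * G.card) (label : (Fin n → Fin w) → β) (T : Finset β)
    (hT : ∀ σ ∈ G, label σ ∈ T)
    (hsep : ∀ σ ∈ G, ∀ τ ∈ G, label σ = label τ → BurstRelated s (List.ofFn σ) (List.ofFn τ) →
      σ = τ) :
    ∃ C : Finset (Fin n → Fin w), C.Nonempty ∧ IsBSDCodeLE s n r C ∧
      redundancy n r C ≤ Real.logb 2 (2 * (T.card : ℝ)) := by
  have hS : 0 < (multiPerms n r).card := (multiPerms_nonempty hr).card_pos
  have hG0 : 0 < G.card := by omega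
  obtain ⟨σ₀, hσ₀⟩ := Finset.card_pos.1 hG0
  have hTne : T.Nonempty := ⟨_, hT _ hσ₀⟩
  have hT0 : (0 : ℝ) < T.card := by exact_mod_cast hTne.card_pos
  obtain ⟨y, -, hy⟩ := Finset.exists_le_card_fiber_of_nsmul_le_card_of_maps_to
    (b := (G.card : ℝ) / T.card) hT hTne (by
      rw [nsmul_eq_mul, mul_div_cancel₀]
      exact hT0.ne')
  set C := G.filter fun σ => label σ = y with hC
  have hGpos : (0 : ℝ) < G.card := by exact_mod_cast hG0
  have hCpos : (0 : ℝ) < C.card := lt_of_lt_of_le (div_pos hGpos hT0) hy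
  refine ⟨C, Finset.card_pos.1 (by exact_mod_cast hCpos), ⟨?_, ?_⟩, ?_⟩
  · exact (Finset.filter_subset _ _).trans hG
  · intro σ hσ τ hτ hne
    by_contra hd
    obtain ⟨h1, h2⟩ := Finset.mem_filter.1 hσ
    obtain ⟨h3, h4⟩ := Finset.mem_filter.1 hτ
    exact hne (hsep σ h1 τ h3 (h2.trans h4.symm)
      (burstRelated_of_not_disjoint (hG h1) (hG h3) hd))
  · have hSpos : (0 : ℝ) < (multiPerms n r).card := by exact_mod_cast hS
    rw [redundancy, ← Real.logb_div hSpos.ne' hCpos.ne']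
    apply Real.logb_le_logb_of_le (by norm_num) (div_pos hSpos hCpos)
    rw [div_le_iff₀ hCpos]
    rw [div_le_iff₀ hT0] at hy
    have : ((multiPerms n r).card : ℝ) ≤ 2 * G.card := by exact_mod_cast hcard
    linarith

/-! ### Single deletions: Varshamov-Tenengolts sums of ascents -/

/-- The number of weak ascents of `p :: l`. -/
def ascents {α : Type*} [LinearOrder α] : α → List α → ℕ
  | _, [] => 0
  | p, x :: l => (if p ≤ x then 1 else 0) + ascents x l

/-- The sum of the positions of the weak ascents of `p :: l`, the first position being `k`. -/
def ascentSum {α : Type*} [LinearOrder α] : ℕ → α → List α → ℕ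
  | _, _, [] => 0
  | k, p, x :: l => k * (if p ≤ x then 1 else 0) + ascentSum (k + 1) x l

section ascents
variable {α : Type*} [LinearOrder α]

theorem ascentSum_succ (k : ℕ) (p : α) (l : List α) :
    ascentSum (k + 1) p l = ascentSum k p l + ascents p l := by
  induction l generalizing k p with
  | nil => rfl
  | cons x l ih => simp only [ascentSum, ascents, ih]; ring

theorem ascentSum_append_cons (k : ℕ) (p x : α) (l l' : List α) :
    ascentSum k p (l ++ x :: l') =
      ascentSum k p (l ++ [x]) + ascentSum (k + l.length + 1) x l' := by
  induction l generalizing k p with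
  | nil => simp [ascentSum]
  | cons y l ih =>
    simp only [List.cons_append, ascentSum, ih, List.length_cons]
    rw [show k + 1 + l.length + 1 = k + (l.length + 1) + 1 by ring]; ring

theorem ascents_append_pair (p y x : α) (l : List α) :
    ascents p (l ++ [y, x]) = ascents p (l ++ [y]) + if y ≤ x then 1 else 0 := by
  induction l generalizing p with
  | nil => simp [ascents]
  | cons z l ih => simp only [List.cons_append, ascents, ih]; ring

theorem exists_ascentSum_append (k : ℕ) (p : α) (A : List α) :
    ∃ (c : ℕ) (p' : α), ∀ l, ascentSum k p (A ++ l) = c + ascentSum (k + A.length) p' l := by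
  induction A generalizing k p with
  | nil => exact ⟨0, p, fun l => by simp⟩
  | cons x A ih =>
    obtain ⟨c, p', h⟩ := ih (k + 1) x
    refine ⟨k * (if p ≤ x then 1 else 0) + c, p', fun l => ?_⟩
    rw [List.cons_append, ascentSum, h, List.length_cons, show k + (A.length + 1) = k + 1 + A.length by ring]
    ring

theorem ascents_le_length (p : α) (l : List α) : ascents p l ≤ l.length := by
  induction l generalizing p with
  | nil => simp [ascents]
  | cons x l ih =>
    have := ih x
    simp only [ascents, List.length_cons]
    split_ifs <;> omega

theorem lt_of_ascents_eq_zero (p x : α) (l : List α) (h : ascents p (l ++ [x]) = 0) : x < p := by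
  induction l generalizing p with
  | nil => simpa [ascents] using h
  | cons y l ih =>
    simp only [List.cons_append, ascents, Nat.add_eq_zero_iff] at h
    have h1 : ¬ p ≤ y := by
      intro hp
      simp [hp] at h
    exact (ih y h.2).trans (not_le.1 h1)

theorem ascents_eq_length_bounds (p x : α) (l : List α)
    (h : ascents p (l ++ [x]) = l.length + 1) : p ≤ x ∧ ∀ y ∈ l, p ≤ y ∧ y ≤ x := by
  induction l generalizing p with
  | nil => simpa [ascents] using h
  | cons z l ih =>
    have hl := ascents_le_length z (l ++ [x])
    simp only [List.cons_append, ascents, List.length_cons, List.length_append, List.length_nil] at h hl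
    have hp : p ≤ z := by
      by_contra hp
      simp [hp] at h
      omega
    simp only [hp, if_true] at h
    obtain ⟨h1, h2⟩ := ih z (by omega)
    refine ⟨hp.trans h1, fun y hy => ?_⟩
    rcases List.mem_cons.1 hy with rfl | hy
    · exact ⟨hp, h1⟩
    · exact ⟨hp.trans (h2 y hy).1, (h2 y hy).2⟩

theorem eq_of_modEq_of_lt {N x y : ℕ} (h : x ≡ y [MOD N]) (h1 : x < y + N) (h2 : y < x + N) :
    x = y := by
  rcases le_total x y with hxy | hxy
  · have := Nat.eq_zero_of_dvd_of_lt ((Nat.modEq_iff_dvd' hxy).1 h) (by omega)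
    omega
  · have := Nat.eq_zero_of_dvd_of_lt ((Nat.modEq_iff_dvd' hxy).1 h.symm) (by omega)
    omega

/-- The difference `l - r = k * e + S - (k + m + 1) * f` is smaller than `N` in absolute value, so
it must vanish. Of the four cases for `e` and `f`, only `e = f = 1` permits this. -/
theorem eq_succ_of_modEq_of_add_eq {N k m l r e f S : ℕ} (hk : 1 ≤ k) (hN : k + m + 1 < N)
    (hmod : l ≡ r [MOD N]) (he : e ≤ 1) (hf : f ≤ 1) (hS : 1 ≤ S) (hSm : S ≤ m + 1)
    (h : l + (k + m + 1) * f = r + k * e + S) : S = m + 1 := by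
  have key := eq_of_modEq_of_lt hmod
  obtain rfl | rfl : e = 0 ∨ e = 1 := by omega
  all_goals obtain rfl | rfl : f = 0 ∨ f = 1 := by omega
  all_goals
    simp only [mul_one, mul_zero, add_zero] at h
    omega

theorem exists_ite_le_add_ite_le (x y z : α) : ∃ e : ℕ, e ≤ 1 ∧
    (if x ≤ y then 1 else 0) + (if y ≤ z then 1 else 0) = e + if x ≤ z then 1 else 0 := by
  by_cases h1 : x ≤ y <;> by_cases h2 : y ≤ z
  · exact ⟨1, le_rfl, by simp [h1, h2, h1.trans h2]⟩
  · by_cases h3 : x ≤ z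
    · exact ⟨0, zero_le_one, by simp [h1, h2, h3]⟩
    · exact ⟨1, le_rfl, by simp [h1, h2, h3]⟩
  · by_cases h3 : x ≤ z
    · exact ⟨0, zero_le_one, by simp [h1, h2, h3]⟩
    · exact ⟨1, le_rfl, by simp [h1, h2, h3]⟩
  · have h3 : ¬ x ≤ z := not_le.2 ((not_le.1 h2).trans (not_le.1 h1))
    exact ⟨0, zero_le_one, by simp [h1, h2, h3]⟩

/-- Moving `b` across `M` changes the sum of the positions of the ascents by a nonzero number of
absolute value at most `k + M.length + 1`, unless nothing changes. -/
theorem ascentSum_move {k : ℕ} (hk : 1 ≤ k) (p b c : α) (M C : List α)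
    (hmod : ∃ N, k + M.length + 1 < N ∧
      ascentSum k p (b :: M ++ c :: C) ≡ ascentSum k p (M ++ b :: c :: C) [MOD N]) :
    b :: M = M ++ [b] := by
  rcases List.eq_nil_or_concat M with rfl | ⟨M₁, z, hM⟩
  · rfl
  obtain ⟨N, hN, hmod⟩ := hmod
  obtain ⟨a, M₂, hM'⟩ : ∃ a M₂, M = a :: M₂ := by
    cases M with
    | nil => simp at hM
    | cons a M₂ => exact ⟨a, M₂, rfl⟩
  have hlen : M.length = M₁.length + 1 := by simp [hM]
  have cons : ∀ (k : ℕ) (p x : α) (l : List α), ascentSum k p (x :: l) =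
      k * (if p ≤ x then 1 else 0) + ascentSum (k + 1) x l := fun _ _ _ _ => rfl
  have key : ∀ (k : ℕ) (p x : α) (l : List α), ascentSum k p (M ++ x :: l) =
      ascentSum k p (M₁.concat z) + ((k + M.length) * (if z ≤ x then 1 else 0) +
        ascentSum (k + M.length + 1) x l) := by
    intro k p x l
    rw [hlen, hM, List.concat_eq_append, List.append_assoc, List.singleton_append,
      ascentSum_append_cons, ascentSum]
    rfl
  -- `S` counts the ascents along the closed path from `b` through `M` back to `b`. It is nonzero,
  -- since a strictly decreasing path cannot return, and it is maximal only if `M` consists of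
  -- copies of `b`.
  set S := ascents b (M ++ [b]) with hS
  have e1 : ascentSum k p (b :: M ++ c :: C) =
      k * (if p ≤ b then 1 else 0) + ((k + 1) * (if b ≤ a then 1 else 0) +
        ascentSum (k + 2) a M₂ + (k + M.length + 1) * (if z ≤ c then 1 else 0)) +
        ascentSum (k + M.length + 2) c C := by
    rw [List.cons_append, cons, key, ← hM, hM', cons]
    rw [← hM', show k + 1 + M.length = k + M.length + 1 by ring,
      show k + 1 + 1 = k + 2 by ring, show k + M.length + 1 + 1 = k + M.length + 2 by ring]
    ring
  have e2 : ascentSum k p (M ++ b :: c :: C) =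
      k * (if p ≤ a then 1 else 0) + ascentSum (k + 1) a M₂ +
        (k + M.length) * (if z ≤ b then 1 else 0) + (k + M.length + 1) * (if b ≤ c then 1 else 0) +
        ascentSum (k + M.length + 2) c C := by
    rw [key, ← hM, hM', cons, cons, ← hM']
    ring
  have e3 : S = (if b ≤ a then 1 else 0) + ascents a M₂ + (if z ≤ b then 1 else 0) := by
    rw [hS, hM, List.concat_eq_append, List.append_assoc, List.singleton_append,
      ascents_append_pair, ← List.concat_eq_append, ← hM, hM', ascents]
  have e4 := ascentSum_succ (k + 1) a M₂
  have hSle : S ≤ M.length + 1 := by simpa using ascents_le_length b (M ++ [b])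
  have hS0 : S ≠ 0 := fun h => lt_irrefl _ (lt_of_ascents_eq_zero b b M h)
  have hSM : S = M.length + 1 := by
    by_contra hne
    have e4' : ascentSum (k + 2) a M₂ = ascentSum (k + 1) a M₂ + ascents a M₂ := e4
    have hS' : 1 ≤ S := Nat.one_le_iff_ne_zero.2 hS0
    -- Inserting `b` between its neighbours at the old and at the new place adds `e` and `f`
    -- ascents.
    obtain ⟨e, he, he'⟩ := exists_ite_le_add_ite_le p b a
    obtain ⟨f, hf, hf'⟩ := exists_ite_le_add_ite_le z b c
    refine hne (eq_succ_of_modEq_of_add_eq hk hN hmod he hf hS' hSle ?_)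
    rw [e1, e2, e3, e4']
    zify at he' hf' ⊢
    linear_combination (k : ℤ) * he' - ((k : ℤ) + M.length + 1) * hf'
  have hall := (ascents_eq_length_bounds b b M hSM).2
  have : M = List.replicate M.length b :=
    List.eq_replicate_iff.2 ⟨rfl, fun y hy => le_antisymm (hall y hy).2 (hall y hy).1⟩
  rw [this, ← List.replicate_succ, List.replicate_succ']

/-- The Varshamov-Tenengolts type sum of the ascents separates words that are related by moving a
single symbol. -/
theorem eq_of_ascentSum_modEq {u v : List α} (p : α) (h : BurstRelated 1 u v)
    (hmod : ascentSum 1 p (u ++ [p]) ≡ ascentSum 1 p (v ++ [p]) [MOD u.length + 2]) : u = v := by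
  have main : ∀ (A M C : List α) (b : α) (N : ℕ), N = A.length + M.length + C.length + 3 →
      ascentSum 1 p (A ++ (b :: M) ++ C ++ [p]) ≡ ascentSum 1 p (A ++ (M ++ [b]) ++ C ++ [p])
        [MOD N] → b :: M = M ++ [b] := by
    intro A M C b N hN h
    obtain ⟨c, p', hA⟩ := exists_ascentSum_append 1 p A
    -- The appended `p` guarantees that the moved symbol has a right neighbour even when `C` is
    -- empty.
    obtain ⟨d, D, hD⟩ : ∃ d D, C ++ [p] = d :: D := by
      cases C with
      | nil => exact ⟨p, [], rfl⟩
      | cons d D => exact ⟨d, D ++ [p], rfl⟩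
    simp only [List.append_assoc, hD] at h
    rw [hA, hA] at h
    refine ascentSum_move (k := 1 + A.length) (by omega) p' b d M D ⟨N, by omega, ?_⟩
    simpa using Nat.ModEq.add_left_cancel' c h
  obtain ⟨A, B, M, B', C, h1, h2, h3, h⟩ := h.cases
  obtain ⟨b, rfl⟩ := List.length_eq_one_iff.1 (le_antisymm h2 h1)
  obtain rfl := List.singleton_perm.1 h3
  rcases h with ⟨rfl, rfl⟩ | ⟨rfl, rfl⟩
  · have := main A M C b _ (by simp; ring) hmod
    rw [← this]; rfl
  · have := main A M C b _ (by simp; ring) hmod.symm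
    rw [← this]; rfl

end ascents

theorem exists_single_deletion_code {n : ℕ} (hn : 2 ≤ n) {w : ℕ} {r : Fin w → ℕ}
    (hr : IsMultiplicityVector n r) :
    ∃ C : Finset (Fin n → Fin w), C.Nonempty ∧ IsBSDCodeLE 1 n r C ∧
      redundancy n r C ≤ Real.logb 2 n + 2 := by
  obtain ⟨p⟩ : Nonempty (Fin w) := by
    obtain ⟨σ, -⟩ := multiPerms_nonempty hr
    exact ⟨σ ⟨0, by omega⟩⟩
  obtain ⟨C, h1, h2, h3⟩ := exists_code_of_label (s := 1) hr (multiPerms n r) subset_rfl (by omega)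
    (fun σ => ascentSum 1 p (List.ofFn σ ++ [p]) % (n + 2)) (Finset.range (n + 2))
    (fun σ _ => Finset.mem_range.2 (Nat.mod_lt _ (by omega)))
    (fun σ _ τ _ h hst => List.ofFn_injective (eq_of_ascentSum_modEq p hst (by
      rw [List.length_ofFn]; exact h)))
  refine ⟨C, h1, h2, h3.trans ?_⟩
  have hn' : (2 : ℝ) ≤ n := by exact_mod_cast hn
  -- The constant 2 suffices because `2 * (n + 2) ≤ 4 * n` for `n ≥ 2`.
  have e : Real.logb 2 n + 2 = Real.logb 2 (n * 4) := by
    rw [Real.logb_mul (by positivity) (by norm_num), show (4 : ℝ) = 2 ^ (2 : ℝ) by norm_num,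
      Real.logb_rpow (by norm_num) (by norm_num)]
  rw [e, Finset.card_range]
  apply Real.logb_le_logb_of_le (by norm_num) (by positivity)
  push_cast
  linarith

/-! ### Colouring short words -/

/-- Greedy colouring of finitely many vertices of a symmetric relation of bounded degree. -/
theorem exists_greedy_coloring {α : Type*} [DecidableEq α] (R : α → α → Prop)
    (hR : ∀ u v, R u v → R v u) (d : ℕ) (N : α → Finset α) (S : Finset α)
    (hd : ∀ u ∈ S, (N u).card ≤ d) (hN : ∀ u ∈ S, ∀ v, R u v → v ∈ N u) :
    ∃ g : α → ℕ, (∀ u, g u ≤ d) ∧ ∀ u ∈ S, ∀ v ∈ S, R u v → g u = g v → u = v := by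
  induction S using Finset.induction_on with
  | empty => exact ⟨fun _ => 0, by simp, by simp⟩
  | insert a S ha ih =>
    obtain ⟨g, hg, hg'⟩ := ih (fun u hu => hd u (Finset.mem_insert_of_mem hu))
      (fun u hu => hN u (Finset.mem_insert_of_mem hu))
    have hlt : ((N a).image g).card < (Finset.range (d + 1)).card := by
      rw [Finset.card_range]
      exact Nat.lt_succ_of_le (Finset.card_image_le.trans (hd a (Finset.mem_insert_self _ _)))
    obtain ⟨c, hc, hc'⟩ := Finset.exists_mem_notMem_of_card_lt_card hlt
    have hne : ∀ v ∈ S, R a v → g v ≠ c := fun v _ hv h =>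
      hc' (h ▸ Finset.mem_image_of_mem g (hN a (Finset.mem_insert_self _ _) v hv))
    refine ⟨Function.update g a c, fun u => ?_, fun u hu v hv huv h => ?_⟩
    · by_cases hu : u = a
      · subst hu
        simpa using Nat.le_of_lt_succ (Finset.mem_range.1 hc)
      · simpa [hu] using hg u
    · rcases Finset.mem_insert.1 hu with hua | hus <;>
        rcases Finset.mem_insert.1 hv with hva | hvs
      · rw [hua, hva]
      · subst hua
        have : v ≠ u := fun h => ha (h ▸ hvs)
        rw [Function.update_self, Function.update_of_ne this] at h
        exact absurd h.symm (hne v hvs huv)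
      · subst hva
        have : u ≠ v := fun h => ha (h ▸ hus)
        rw [Function.update_self, Function.update_of_ne this] at h
        exact absurd h (hne u hus (hR _ _ huv))
      · have hu' : u ≠ a := fun h => ha (h ▸ hus)
        have hv' : v ≠ a := fun h => ha (h ▸ hvs)
        rw [Function.update_of_ne hu', Function.update_of_ne hv'] at h
        exact hg' u hus v hvs huv h

/-- The lists that are burst related to `u`. -/
def burstNeighbors {α : Type*} [DecidableEq α] (s : ℕ) (u : List α) : Finset (List α) :=
  (Finset.range (u.length + 1)).biUnion fun i => (Finset.range (u.length + 1)).biUnion fun j =>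
    (Finset.range (s + 1)).biUnion fun t =>
      ((u.drop i).take t).permutations.toFinset.image fun x =>
        (u.take i ++ u.drop (i + t)).take j ++ x ++ (u.take i ++ u.drop (i + t)).drop j

theorem mem_burstNeighbors {α : Type*} [DecidableEq α] {s : ℕ} {u v : List α}
    (h : BurstRelated s u v) : v ∈ burstNeighbors s u := by
  obtain ⟨p₁, x₁, q₁, p₂, x₂, q₂, rfl, rfl, h3, h4, h5, h6⟩ := h
  have hlen := congrArg List.length h3
  simp only [List.length_append] at hlen
  have e1 : (p₁ ++ x₁ ++ q₁).take p₁.length = p₁ := by simp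
  have e2 : (p₁ ++ x₁ ++ q₁).drop (p₁.length + x₁.length) = q₁ := by
    rw [← List.length_append, List.drop_left]
  have e3 : ((p₁ ++ x₁ ++ q₁).drop p₁.length).take x₁.length = x₁ := by simp
  simp only [burstNeighbors, Finset.mem_biUnion, Finset.mem_range, Finset.mem_image,
    List.mem_toFinset, List.mem_permutations, List.length_append]
  refine ⟨p₁.length, by omega, p₂.length, by omega, x₁.length, by omega, x₂, ?_, ?_⟩
  · rw [e3]; exact h6.symm
  · rw [e1, e2, h3]; simp

/-- As the reinserted block is a permutation of the deleted one, the bound does not involve the size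
of the alphabet; otherwise `w` would enter the redundancy. -/
theorem card_burstNeighbors_le {α : Type*} [DecidableEq α] (s : ℕ) (u : List α) :
    (burstNeighbors s u).card ≤ (u.length + 1) * ((u.length + 1) * ((s + 1) * s.factorial)) := by
  refine (Finset.card_biUnion_le_card_mul _ _ _ fun i _ =>
    Finset.card_biUnion_le_card_mul _ _ _ fun j _ =>
    Finset.card_biUnion_le_card_mul _ _ s.factorial fun t ht => ?_).trans (by simp)
  refine Finset.card_image_le.trans ((List.toFinset_card_le _).trans ?_)
  rw [List.length_permutations]
  refine Nat.factorial_le ?_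
  have := Finset.mem_range.1 ht
  rw [List.length_take]
  omega

/-- The number of colours that suffice for lists of length at most `l`. -/
def burstColors (s l : ℕ) : ℕ := (l + 1) * ((l + 1) * ((s + 1) * s.factorial)) + 1

theorem exists_burst_coloring (α : Type*) [Finite α] (s l : ℕ) :
    ∃ g : List α → ℕ, (∀ u, g u < burstColors s l) ∧
      ∀ u v : List α, u.length ≤ l → v.length ≤ l → BurstRelated s u v → g u = g v → u = v := by
  classical
  obtain ⟨g, h1, h2⟩ := exists_greedy_coloring (BurstRelated s) (fun _ _ => BurstRelated.symm)
    ((l + 1) * ((l + 1) * ((s + 1) * s.factorial))) (burstNeighbors s)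
    (List.finite_length_le α l).toFinset
    (fun u hu => by
      have hu : u.length ≤ l := by simpa using hu
      refine (card_burstNeighbors_le s u).trans ?_
      gcongr)
    (fun u _ v => mem_burstNeighbors)
  refine ⟨g, fun u => Nat.lt_succ_of_le (h1 u), fun u v hu hv => h2 u ?_ v ?_⟩
  · simpa using hu
  · simpa using hv

/-! ### Recovering a localized burst -/

/-- The sum of the colours of the windows of length `2 * P` that start at odd (`e = 1`) or even
(`e = 0`) multiples of `P`. -/
def windowSum {α : Type*} (g : List α → ℕ) (P e n : ℕ) (l : List α) : ℕ :=
  ∑ k ∈ Finset.range n, g ((l.drop ((2 * k + e) * P)).take (2 * P))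

theorem window_eq_of_disjoint {α : Type*} (X U V Y : List α) (hUV : U.length = V.length) (a b : ℕ)
    (h : a + b ≤ X.length ∨ X.length + U.length ≤ a) :
    ((X ++ U ++ Y).drop a).take b = ((X ++ V ++ Y).drop a).take b := by
  apply List.ext_getElem?
  intro i
  simp only [List.getElem?_take, List.getElem?_drop]
  split_ifs with hi
  · rcases h with h | h
    · rw [List.append_assoc, List.append_assoc, List.getElem?_append_left (by omega),
        List.getElem?_append_left (by omega)]
    · rw [List.getElem?_append_right (by simp; omega), List.getElem?_append_right (by simp; omega)]
      simp [hUV]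
  · rfl

theorem window_eq_of_subset {α : Type*} (X U Y : List α) (a b : ℕ) (h1 : a ≤ X.length)
    (h2 : X.length + U.length ≤ a + b) :
    ((X ++ U ++ Y).drop a).take b =
      X.drop a ++ U ++ Y.take (a + b - (X.length + U.length)) := by
  rw [List.append_assoc, List.drop_append_of_le_length h1, List.take_append,
    List.take_of_length_le (by simp; omega), List.take_append,
    List.take_of_length_le (l := U) (by simp; omega), List.append_assoc, List.length_drop,
    show b - (X.length - a) - U.length = a + b - (X.length + U.length) by omega]

/-- Equal window sums recover a burst that is confined to `P` consecutive positions. -/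
theorem eq_of_windowSum_modEq {α : Type*} {s n P : ℕ} {g : List α → ℕ} {N : ℕ}
    (hgN : ∀ u, g u < N)
    (hg : ∀ u v : List α, u.length ≤ 2 * P → v.length ≤ 2 * P → BurstRelated s u v → g u = g v →
      u = v)
    {A B M B' C : List α} (h1 : 1 ≤ B.length) (hs : B.length ≤ s) (hB : B.Perm B')
    (hP : B.length + M.length ≤ P) (hn : A.length < n)
    (hmod : ∀ e < 2, windowSum g P e n (A ++ (B ++ M) ++ C) ≡
      windowSum g P e n (A ++ (M ++ B') ++ C) [MOD N]) :
    A ++ (B ++ M) ++ C = A ++ (M ++ B') ++ C := by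
  have hP0 : 0 < P := by omega
  -- The changed part starts in the `q`th block of length `P` and is at most `P` long, so it lies in
  -- the window that starts at `q * P`. The other windows of the same parity are disjoint from that
  -- one, so only one summand can change.
  set q := A.length / P with hq
  have hq1 : q * P ≤ A.length := Nat.div_mul_le_self _ _
  have hq2 : A.length < q * P + P := by
    have := Nat.lt_div_mul_add (a := A.length) hP0
    simpa [hq] using this
  have hqn : q / 2 < n := (Nat.div_le_self _ _).trans_lt ((Nat.div_le_self _ _).trans_lt hn)
  have hlen : (B ++ M).length = (M ++ B').length := by simp [hB.length_eq, add_comm]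
  have hU : (B ++ M).length ≤ P := by simpa using hP
  have hqe : 2 * (q / 2) + q % 2 = q := Nat.div_add_mod q 2
  have key := hmod (q % 2) (Nat.mod_lt _ two_pos)
  rw [windowSum, windowSum, ← Finset.add_sum_erase _ _ (Finset.mem_range.2 hqn),
    ← Finset.add_sum_erase _ _ (Finset.mem_range.2 hqn)] at key
  have hrest : ∀ k ∈ (Finset.range n).erase (q / 2),
      g (((A ++ (B ++ M) ++ C).drop ((2 * k + q % 2) * P)).take (2 * P)) =
      g (((A ++ (M ++ B') ++ C).drop ((2 * k + q % 2) * P)).take (2 * P)) := by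
    intro k hk
    have hk := (Finset.mem_erase.1 hk).1
    rw [window_eq_of_disjoint A _ _ C hlen]
    rcases Nat.lt_or_gt_of_ne hk with hk | hk
    · left
      have : (2 * k + q % 2 + 2) * P ≤ q * P := Nat.mul_le_mul_right _ (by omega)
      nlinarith
    · right
      have : (q + 2) * P ≤ (2 * k + q % 2) * P := Nat.mul_le_mul_right _ (by omega)
      nlinarith
  rw [Finset.sum_congr rfl hrest, hqe] at key
  have key := Nat.ModEq.add_right_cancel' _ key
  have key := Nat.ModEq.eq_of_lt_of_lt key (hgN _) (hgN _)
  have hw := hg _ _ (by simp) (by simp) ?_ key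
  · rw [window_eq_of_subset _ _ _ _ _ hq1 (by omega), window_eq_of_subset _ _ _ _ _ hq1 (by omega),
      ← hlen] at hw
    rw [List.append_cancel_left (List.append_cancel_right hw)]
  · rw [window_eq_of_subset _ _ _ _ _ hq1 (by omega), window_eq_of_subset _ _ _ _ _ hq1 (by omega),
      ← hlen]
    exact burstRelated_of_perm _ _ _ h1 hs hB

/-! ### Localizing the burst by marked positions -/

/-- The sum of the positions of the marked entries of a list. -/
def markSum {α : Type*} (mark : α → Bool) : List α → ℕ
  | [] => 0
  | _ :: l => markSum mark l + l.countP mark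

theorem markSum_append {α : Type*} (mark : α → Bool) (l l' : List α) :
    markSum mark (l ++ l') = markSum mark l + markSum mark l' + l.length * l'.countP mark := by
  induction l with
  | nil => simp [markSum]
  | cons a l ih =>
    simp only [List.cons_append, markSum, ih, List.countP_append, List.length_cons]
    ring

theorem markSum_le {α : Type*} (mark : α → Bool) (l : List α) :
    markSum mark l ≤ l.length ^ 2 := by
  induction l with
  | nil => simp [markSum]
  | cons a l ih =>
    have := List.countP_le_length (p := mark) (l := l)
    simp only [markSum, List.length_cons]
    nlinarith

/-- Every long enough block of `l` has some marked entries, but not too many. -/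
def EvenlyMarked {α : Type*} (mark : α → Bool) (s L : ℕ) (l : List α) : Prop :=
  ∀ U M V, l = U ++ M ++ V → L ≤ M.length →
    s ^ 2 < M.countP mark ∧ 2 * s * M.countP mark ≤ M.length

/-- The sum of the positions of the marked entries localizes the burst. -/
theorem length_lt_of_markSum_modEq {α : Type*} {mark : α → Bool} {s L n : ℕ} {A B M B' C : List α}
    (h1 : 1 ≤ B.length) (hs : B.length ≤ s) (hB : B.Perm B') (hL : 2 * s ^ 2 < L)
    (hM : M.length ≤ n) (hl : EvenlyMarked mark s L (A ++ (B ++ M) ++ C))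
    (hmod : markSum mark (A ++ (B ++ M) ++ C) ≡ markSum mark (A ++ (M ++ B') ++ C)
      [MOD s * n + s ^ 2 + 1]) : M.length < L := by
  by_contra hlt
  obtain ⟨hlow, hup⟩ := hl (A ++ B) M C (by simp) (not_lt.1 hlt)
  have e1 : (B ++ M).countP mark = (M ++ B').countP mark := by
    rw [List.countP_append, List.countP_append, hB.countP_eq, add_comm]
  have e2 : (A ++ (B ++ M)).length = (A ++ (M ++ B')).length := by
    simp [hB.length_eq, add_comm]
  rw [markSum_append, markSum_append _ _ C, markSum_append _ A, markSum_append _ A, e1, e2] at hmod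
  have hmod := Nat.ModEq.add_left_cancel' _
    (Nat.ModEq.add_right_cancel' _ (Nat.ModEq.add_right_cancel' _
      (Nat.ModEq.add_right_cancel' _ hmod)))
  rw [markSum_append, markSum_append] at hmod
  have f1 : markSum mark B ≤ s ^ 2 := (markSum_le mark B).trans (Nat.pow_le_pow_left hs 2)
  have f2 : markSum mark B' ≤ s ^ 2 :=
    (markSum_le mark B').trans (Nat.pow_le_pow_left (hB.length_eq ▸ hs) 2)
  have f3 : M.countP mark ≤ M.length := List.countP_le_length
  have f4 : B'.countP mark ≤ s := List.countP_le_length.trans (hB.length_eq ▸ hs)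
  have f5 : B.length * M.countP mark ≤ s * n := Nat.mul_le_mul hs (f3.trans hM)
  have f6 : M.length * B'.countP mark ≤ s * n := by
    rw [mul_comm s]; exact Nat.mul_le_mul hM f4
  -- Up to terms of size at most `s ^ 2`, the claim compares `B.length * M.countP mark` with
  -- `M.length * B'.countP mark`. If `B'` is unmarked, the first product exceeds `s ^ 2`; otherwise
  -- the second is at least `M.length`, which exceeds the first by more than `s ^ 2`.
  have key := eq_of_modEq_of_lt hmod (by omega) (by omega)
  rcases Nat.eq_zero_or_pos (B'.countP mark) with h0 | h0
  · rw [h0] at key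
    have : 1 * M.countP mark ≤ B.length * M.countP mark := Nat.mul_le_mul_right _ h1
    omega
  · have f7 : M.length * 1 ≤ M.length * B'.countP mark := Nat.mul_le_mul_left _ h0
    have f8 : B.length * M.countP mark ≤ s * M.countP mark := Nat.mul_le_mul_right _ hs
    have f9 : 2 * s * M.countP mark = 2 * (s * M.countP mark) := by ring
    omega

/-- The label of a word: a localization of the burst and the colours of the windows. -/
def burstLabel {α : Type*} (mark : α → Bool) (g : List α → ℕ) (s P n N : ℕ) (l : List α) :
    ℕ × ℕ × ℕ :=
  (markSum mark l % (s * n + s ^ 2 + 1), windowSum g P 0 n l % N, windowSum g P 1 n l % N)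

theorem eq_of_burstLabel_eq {α : Type*} {mark : α → Bool} {g : List α → ℕ} {s L n N : ℕ}
    (hgN : ∀ u, g u < N)
    (hg : ∀ u v : List α, u.length ≤ 2 * (L + s) → v.length ≤ 2 * (L + s) → BurstRelated s u v →
      g u = g v → u = v)
    (hL : 2 * s ^ 2 < L) {u v : List α} (hu : u.length = n) (hv : v.length = n)
    (hmu : EvenlyMarked mark s L u) (hmv : EvenlyMarked mark s L v) (h : BurstRelated s u v)
    (hlab : burstLabel mark g s (L + s) n N u = burstLabel mark g s (L + s) n N v) : u = v := by
  have main : ∀ A B M B' C : List α, 1 ≤ B.length → B.length ≤ s → B.Perm B' →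
      (A ++ (B ++ M) ++ C).length = n → EvenlyMarked mark s L (A ++ (B ++ M) ++ C) →
      burstLabel mark g s (L + s) n N (A ++ (B ++ M) ++ C) =
        burstLabel mark g s (L + s) n N (A ++ (M ++ B') ++ C) →
      A ++ (B ++ M) ++ C = A ++ (M ++ B') ++ C := by
    intro A B M B' C h1 hs hB hn hm hlab
    simp only [burstLabel, Prod.mk.injEq] at hlab
    simp only [List.length_append] at hn
    have := length_lt_of_markSum_modEq (n := n) h1 hs hB hL (by omega) hm hlab.1
    refine eq_of_windowSum_modEq hgN hg h1 hs hB (by omega) (n := n) (by omega) fun e he => ?_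
    interval_cases e
    · exact hlab.2.1
    · exact hlab.2.2
  obtain ⟨A, B, M, B', C, h1, hs, hB, ⟨rfl, rfl⟩ | ⟨rfl, rfl⟩⟩ := h.cases
  · exact main A B M B' C h1 hs hB hu hmu hlab
  · exact (main A B M B' C h1 hs hB hv hmv hlab.symm).symm

/-- A marking for which many words are evenly marked gives a code. -/
theorem exists_code_of_marking {s n w : ℕ} {r : Fin w → ℕ}
    (hr : IsMultiplicityVector n r) (mark : Fin w → Bool) {L : ℕ} (hL : 2 * s ^ 2 < L)
    (G : Finset (Fin n → Fin w)) (hG : G ⊆ multiPerms n r)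
    (hcard : (multiPerms n r).card ≤ 2 * G.card)
    (hmark : ∀ σ ∈ G, EvenlyMarked mark s L (List.ofFn σ)) :
    ∃ C : Finset (Fin n → Fin w), C.Nonempty ∧ IsBSDCodeLE s n r C ∧
      redundancy n r C ≤ Real.logb 2
        (2 * ((s * n + s ^ 2 + 1) * burstColors s (2 * (L + s)) ^ 2 : ℕ)) := by
  obtain ⟨g, hgN, hg⟩ := exists_burst_coloring (Fin w) s (2 * (L + s))
  set N := burstColors s (2 * (L + s)) with hN
  have hN0 : 0 < N := Nat.succ_pos _
  obtain ⟨C, h1, h2, h3⟩ := exists_code_of_label (s := s) hr G hG hcard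
    (fun σ => burstLabel mark g s (L + s) n N (List.ofFn σ))
    (Finset.range (s * n + s ^ 2 + 1) ×ˢ Finset.range N ×ˢ Finset.range N)
    (fun σ _ => by
      simp only [burstLabel, Finset.mem_product, Finset.mem_range]
      exact ⟨Nat.mod_lt _ (Nat.succ_pos _), Nat.mod_lt _ hN0, Nat.mod_lt _ hN0⟩)
    (fun σ hσ τ hτ h hst => List.ofFn_injective (eq_of_burstLabel_eq hgN hg hL (by simp) (by simp)
      (hmark σ hσ) (hmark τ hτ) hst h))
  refine ⟨C, h1, h2, h3.trans_eq ?_⟩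
  simp only [Finset.card_product, Finset.card_range]
  rw [sq N]

/-! ### Random markings -/

/-- The marking of the symbols that a function sends to zero. -/
def zeroMark {α : Type*} {q : ℕ} (h : α → Fin q) (a : α) : Bool := decide ((h a : ℕ) = 0)

theorem countP_eq_sum_count {α : Type*} [Fintype α] [DecidableEq α] (p : α → Bool) (l : List α) :
    l.countP p = ∑ a, if p a then l.count a else 0 := by
  induction l with
  | nil => simp
  | cons b l ih =>
    have : ∀ a, (if p a then (b :: l).count a else 0) =
        (if p a then l.count a else 0) + if b = a then (if p b then 1 else 0) else 0 := by
      intro a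
      rw [List.count_cons]
      by_cases h : b = a
      · subst h; by_cases hp : p b <;> simp [hp]
      · simp [h]
    rw [List.countP_cons, ih, Finset.sum_congr rfl fun a _ => this a, Finset.sum_add_distrib]
    simp

/-- The moment generating function factors because symbols are marked independently: one of the `q`
values of `h a` marks all copies of `a`, and the others mark none. -/
theorem sum_pow_countP_zeroMark {α : Type*} [Fintype α] [DecidableEq α] {q : ℕ} (hq : 0 < q)
    (x : ℝ) (l : List α) :
    ∑ h : α → Fin q, x ^ l.countP (zeroMark h) = ∏ a : α, (x ^ l.count a + ((q : ℝ) - 1)) := by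
  obtain ⟨q, rfl⟩ := Nat.exists_eq_succ_of_ne_zero hq.ne'
  have : ∀ a : α, x ^ l.count a + (((q + 1 : ℕ) : ℝ) - 1) =
      ∑ v : Fin (q + 1), if (v : ℕ) = 0 then x ^ l.count a else 1 := by
    intro a
    rw [Fin.sum_univ_succ]
    simp
  simp only [Nat.succ_eq_add_one, this]
  rw [Finset.prod_univ_sum, Fintype.piFinset_univ]
  refine Finset.sum_congr rfl fun h _ => ?_
  rw [countP_eq_sum_count, ← Finset.prod_pow_eq_pow_sum]
  refine Finset.prod_congr rfl fun a _ => ?_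
  by_cases ha : (h a : ℕ) = 0 <;> simp [zeroMark, ha]

theorem sum_pow_countP_zeroMark_le {α : Type*} [Fintype α] [DecidableEq α] {q : ℕ} (hq : 0 < q)
    {x y : ℝ} (hx : 0 ≤ x) (l : List α)
    (h : ∀ a, x ^ l.count a + ((q : ℝ) - 1) ≤ y ^ l.count a * q) :
    ∑ h : α → Fin q, x ^ l.countP (zeroMark h) ≤ y ^ l.length * (q : ℝ) ^ Fintype.card α := by
  have hq1 : (1 : ℝ) ≤ q := by exact_mod_cast hq
  rw [sum_pow_countP_zeroMark hq]
  refine (Finset.prod_le_prod (fun a _ => ?_) fun a _ => h a).trans_eq ?_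
  · have := pow_nonneg hx (l.count a)
    linarith
  · rw [Finset.prod_mul_distrib, Finset.prod_pow_eq_pow_sum, Finset.prod_const, Finset.card_univ]
    congr 2
    have := countP_eq_sum_count (fun _ => true) l
    simpa using this.symm

/-- Markov's inequality for counting. -/
theorem card_filter_mul_le_sum {β : Type*} [Fintype β] (p : β → Prop) [DecidablePred p] (f : β → ℝ)
    (hf : ∀ b, 0 ≤ f b) (x : ℝ) (h : ∀ b, p b → x ≤ f b) :
    ((Finset.univ.filter p).card : ℝ) * x ≤ ∑ b, f b := by
  rw [← nsmul_eq_mul]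
  exact (Finset.card_nsmul_le_sum _ _ _ fun b hb => h b (Finset.mem_filter.1 hb).2).trans
    (Finset.sum_le_sum_of_subset_of_nonneg (Finset.filter_subset _ _) fun b _ _ => hf b)

/-- Few markings of a word with bounded multiplicities have too few or too many marked entries. -/
theorem exists_bound_card_bad_zeroMark (s ρ : ℕ) (hρ : 1 ≤ ρ) :
    ∃ (q : ℕ) (β : ℝ), 0 < q ∧ 0 < β ∧ β < 1 ∧ ∀ (w : ℕ) (l : List (Fin w)),
      (∀ a, l.count a ≤ ρ) →
      ((Finset.univ.filter fun h : Fin w → Fin q => ¬ (s ^ 2 < l.countP (zeroMark h) ∧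
        2 * s * l.countP (zeroMark h) ≤ l.length)).card : ℝ) ≤
      2 ^ (s ^ 2 + 1) * β ^ l.length * (q : ℝ) ^ w := by
  -- This `q` makes `(2 ^ (4 * s)) ^ c ≤ q` for every multiplicity `c ≤ ρ`, which controls the upper
  -- tail. The lower tail uses base `1 / 2`, and `β` is chosen so that Bernoulli's inequality gives
  -- `β ^ ρ ≥ 1 - 1 / (2 * q)`.
  set q : ℕ := 2 ^ (4 * s * ρ) with hq
  set β : ℝ := 1 - 1 / (2 * q * ρ) with hβ
  have hq0 : 0 < q := by positivity
  have hq1 : (1 : ℝ) ≤ q := by exact_mod_cast hq0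
  have hρ1 : (1 : ℝ) ≤ ρ := by exact_mod_cast hρ
  have hd : (2 : ℝ) ≤ 2 * q * ρ := by nlinarith
  have hβhalf : 1 / 2 ≤ β := by
    have : 1 / (2 * q * ρ : ℝ) ≤ 1 / 2 := one_div_le_one_div_of_le (by norm_num) hd
    linarith
  have hβ1 : β < 1 := by
    have : 0 < 1 / (2 * q * ρ : ℝ) := by positivity
    linarith
  refine ⟨q, β, hq0, by linarith, hβ1, fun w l hl => ?_⟩
  have hlow := card_filter_mul_le_sum (fun h : Fin w → Fin q => l.countP (zeroMark h) ≤ s ^ 2)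
    (fun h => (1 / 2 : ℝ) ^ l.countP (zeroMark h)) (fun h => by positivity) ((1 / 2) ^ (s ^ 2))
    (fun h hh => pow_le_pow_of_le_one (by norm_num) (by norm_num) hh)
  have hup := card_filter_mul_le_sum
    (fun h : Fin w → Fin q => l.length < 2 * s * l.countP (zeroMark h))
    (fun h => ((2 : ℝ) ^ (4 * s)) ^ l.countP (zeroMark h)) (fun h => by positivity)
    (4 ^ l.length) (fun h hh => by
      rw [← pow_mul, show (4 : ℝ) = 2 ^ 2 by norm_num, ← pow_mul]
      refine pow_le_pow_right₀ (by norm_num) ?_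
      nlinarith)
  have hlow' := hlow.trans (sum_pow_countP_zeroMark_le hq0 (y := β) (by norm_num) l fun a => by
    rcases Nat.eq_zero_or_pos (l.count a) with h0 | h0
    · simp [h0]
    · have h1 : (1 / 2 : ℝ) ^ l.count a ≤ 1 / 2 := by
        simpa using pow_le_pow_of_le_one (a := (1 / 2 : ℝ)) (by norm_num) (by norm_num) h0
      have h2 : β ^ ρ ≤ β ^ l.count a := pow_le_pow_of_le_one (by linarith) hβ1.le (hl a)
      have h3 := one_add_mul_le_pow (a := -(1 / (2 * q * ρ : ℝ))) (by linarith) ρ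
      rw [← sub_eq_add_neg, ← hβ] at h3
      have h4 : (ρ : ℝ) * -(1 / (2 * q * ρ)) = -(1 / (2 * q)) := by field_simp
      rw [h4] at h3
      have h5 : (1 + -(1 / (2 * q : ℝ))) * q = q - 1 / 2 := by field_simp; ring
      have h6 := mul_le_mul_of_nonneg_right (h3.trans h2) (by linarith : (0 : ℝ) ≤ q)
      linarith)
  have hup' := hup.trans (sum_pow_countP_zeroMark_le hq0 (y := 2) (by positivity) l fun a => by
    rcases Nat.eq_zero_or_pos (l.count a) with h0 | h0
    · simp [h0]
    · have h1 : ((2 : ℝ) ^ (4 * s)) ^ l.count a ≤ q := by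
        rw [← pow_mul, hq]
        push_cast
        exact pow_le_pow_right₀ (by norm_num) (Nat.mul_le_mul_left _ (hl a))
      have h2 : (2 : ℝ) ≤ 2 ^ l.count a := by
        simpa using pow_le_pow_right₀ (a := (2 : ℝ)) (by norm_num) h0
      nlinarith)
  rw [Fintype.card_fin] at hlow' hup'
  have hcard : ((Finset.univ.filter fun h : Fin w → Fin q => ¬ (s ^ 2 < l.countP (zeroMark h) ∧
        2 * s * l.countP (zeroMark h) ≤ l.length)).card : ℝ) ≤
      (Finset.univ.filter fun h : Fin w → Fin q => l.countP (zeroMark h) ≤ s ^ 2).card +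
      (Finset.univ.filter fun h : Fin w → Fin q =>
        l.length < 2 * s * l.countP (zeroMark h)).card := by
    rw [← Nat.cast_add]
    refine Nat.cast_le.2 (le_trans (Finset.card_le_card ?_) (Finset.card_union_le _ _))
    intro h hh
    simp only [Finset.mem_filter, Finset.mem_univ, true_and, Finset.mem_union] at hh ⊢
    omega
  generalize (((Finset.univ.filter fun h : Fin w → Fin q =>
    l.countP (zeroMark h) ≤ s ^ 2).card : ℕ) : ℝ) = X at *
  generalize (((Finset.univ.filter fun h : Fin w → Fin q =>
    l.length < 2 * s * l.countP (zeroMark h)).card : ℕ) : ℝ) = Y at *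
  have hX : X ≤ 2 ^ s ^ 2 * (β ^ l.length * q ^ w) := by
    rw [one_div, inv_pow, ← div_eq_mul_inv, div_le_iff₀ (by positivity)] at hlow'
    linarith
  have hY : Y ≤ 2 ^ s ^ 2 * (β ^ l.length * q ^ w) := by
    have h4 : (4 : ℝ) ^ l.length = 2 ^ l.length * 2 ^ l.length := by
      rw [← mul_pow]; norm_num
    have h2 : (0 : ℝ) < 2 ^ l.length := by positivity
    have h5 : Y * 2 ^ l.length ≤ q ^ w := by
      refine le_of_mul_le_mul_left ?_ h2
      calc _ = Y * 4 ^ l.length := by rw [h4]; ring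
        _ ≤ _ := hup'
    have h6 : (1 : ℝ) ≤ 2 ^ l.length * β ^ l.length := by
      rw [← mul_pow]
      exact one_le_pow₀ (by linarith)
    have h7 : Y ≤ β ^ l.length * q ^ w := by
      refine le_of_mul_le_mul_left ?_ h2
      have : (0 : ℝ) ≤ (q : ℝ) ^ w := by positivity
      nlinarith
    have h8 : (1 : ℝ) ≤ 2 ^ s ^ 2 := one_le_pow₀ (by norm_num)
    have h9 : 0 ≤ β ^ l.length * (q : ℝ) ^ w := by
      have : 0 < β := by linarith
      positivity
    nlinarith
  rw [pow_succ _ (s ^ 2)]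
  linarith

open Classical in
/-- Half of all markings are even on a given word whose symbols have bounded multiplicities. -/
theorem exists_two_mul_card_not_evenlyMarked_le (s ρ : ℕ) (hρ : 1 ≤ ρ) :
    ∃ q D : ℕ, 0 < q ∧ 2 * s ^ 2 < D ∧ ∀ (n w : ℕ) (l : List (Fin w)), 2 ≤ n → l.length = n →
      (∀ a, l.count a ≤ ρ) →
      2 * ((Finset.univ : Finset (Fin w → Fin q)).filter fun h =>
        ¬ EvenlyMarked (zeroMark h) s (D * Nat.log 2 n) l).card ≤ q ^ w := by
  obtain ⟨q, β, hq, hβ0, hβ1, hbad⟩ := exists_bound_card_bad_zeroMark s ρ hρ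
  -- The exponent absorbs, for each unit of `Nat.log 2 n`, a factor 16 for the at most `n ^ 2`
  -- blocks and the factor `2 ^ s ^ 2`, and still leaves `1 / 4`.
  obtain ⟨D₀, hD₀⟩ := exists_pow_lt_of_lt_one (show (0 : ℝ) < (1 / 2) ^ (s ^ 2 + 6) by positivity) hβ1
  refine ⟨q, D₀ + (2 * s ^ 2 + 1), hq, by omega, fun n w l hn hl hcount => ?_⟩
  set D := D₀ + (2 * s ^ 2 + 1) with hD
  set k := Nat.log 2 n with hk
  have hk1 : 1 ≤ k := Nat.log_pos (by norm_num) hn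
  have hβD : β ^ D ≤ (1 / 2) ^ (s ^ 2 + 6) :=
    (pow_le_pow_of_le_one hβ0.le hβ1.le (by omega)).trans hD₀.le
  have hn2 : (n : ℝ) ≤ 4 ^ k := by
    have h1 : n < 2 ^ (k + 1) := Nat.lt_pow_succ_log_self (by norm_num) n
    have h2 : 2 ^ (k + 1) ≤ 2 ^ (2 * k) := Nat.pow_le_pow_right (by norm_num) (by omega)
    have h3 : n ≤ 4 ^ k := by
      rw [pow_mul] at h2
      exact h1.le.trans h2
    exact_mod_cast h3
  have hsub : ((Finset.univ : Finset (Fin w → Fin q)).filter fun h =>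
        ¬ EvenlyMarked (zeroMark h) s (D * k) l) ⊆
      (((Finset.range n ×ˢ Finset.range n).filter fun p =>
        D * k ≤ ((l.drop p.1).take (p.2 + 1)).length).biUnion fun p =>
        Finset.univ.filter fun h : Fin w → Fin q =>
          ¬ (s ^ 2 < ((l.drop p.1).take (p.2 + 1)).countP (zeroMark h) ∧
            2 * s * ((l.drop p.1).take (p.2 + 1)).countP (zeroMark h) ≤
              ((l.drop p.1).take (p.2 + 1)).length)) := by
    intro h hh
    have hh := (Finset.mem_filter.1 hh).2
    simp only [EvenlyMarked, not_forall] at hh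
    obtain ⟨U, M, V, rfl, hM, hb⟩ := hh
    have hM1 : 1 ≤ M.length := le_trans (Nat.mul_pos (by omega) hk1) hM
    simp only [List.length_append] at hl
    have e : ((U ++ M ++ V).drop U.length).take (M.length - 1 + 1) = M := by
      rw [Nat.sub_add_cancel hM1, List.append_assoc, List.drop_left, List.take_left]
    refine Finset.mem_biUnion.2 ⟨(U.length, M.length - 1), Finset.mem_filter.2
      ⟨Finset.mem_product.2 ⟨Finset.mem_range.2 ?_, Finset.mem_range.2 ?_⟩, ?_⟩,
      Finset.mem_filter.2 ⟨Finset.mem_univ _, ?_⟩⟩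
    · dsimp only; omega
    · dsimp only; omega
    · rw [e]; exact hM
    · rw [e]; exact hb
  have hcard : (((Finset.univ : Finset (Fin w → Fin q)).filter fun h =>
        ¬ EvenlyMarked (zeroMark h) s (D * k) l).card : ℝ) ≤
      n * n * (2 ^ (s ^ 2 + 1) * β ^ (D * k) * (q : ℝ) ^ w) := by
    refine (Nat.cast_le.2 ((Finset.card_le_card hsub).trans Finset.card_biUnion_le)).trans ?_
    rw [Nat.cast_sum]
    refine (Finset.sum_le_card_nsmul _ _ (2 ^ (s ^ 2 + 1) * β ^ (D * k) * (q : ℝ) ^ w)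
      fun p hp => ?_).trans ?_
    · refine (hbad w _ fun a => ?_).trans ?_
      · exact (((List.take_sublist _ _).trans (List.drop_sublist _ _)).count_le a).trans (hcount a)
      · have := pow_le_pow_of_le_one hβ0.le hβ1.le (Finset.mem_filter.1 hp).2
        gcongr
    · rw [nsmul_eq_mul]
      refine mul_le_mul_of_nonneg_right ?_ (by positivity)
      have := (Finset.card_filter_le (Finset.range n ×ˢ Finset.range n) fun p =>
        D * k ≤ ((l.drop p.1).take (p.2 + 1)).length)
      rw [Finset.card_product, Finset.card_range] at this
      exact_mod_cast this
  have hsmall : (n : ℝ) * n * (2 ^ (s ^ 2 + 1) * β ^ (D * k)) ≤ 1 / 2 := by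
    have h1 : β ^ (D * k) ≤ ((1 / 2) ^ (s ^ 2 + 6)) ^ k := by
      rw [pow_mul]
      exact pow_le_pow_left₀ (by positivity) hβD k
    have h2 : (n : ℝ) * n ≤ 4 ^ k * 4 ^ k := by gcongr
    have h3 : (2 : ℝ) ^ (s ^ 2 + 1) ≤ 2 * (2 ^ s ^ 2) ^ k := by
      rw [pow_succ, mul_comm]
      have : (1 : ℝ) ≤ 2 ^ s ^ 2 := one_le_pow₀ (by norm_num)
      have := le_self_pow₀ this (by omega : k ≠ 0)
      linarith
    calc (n : ℝ) * n * (2 ^ (s ^ 2 + 1) * β ^ (D * k))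
        ≤ (4 ^ k * 4 ^ k) * ((2 * (2 ^ s ^ 2) ^ k) * ((1 / 2) ^ (s ^ 2 + 6)) ^ k) := by gcongr
      _ = 2 * (1 / 4) ^ k := by
        have : (4 * 4 * (2 ^ s ^ 2) * (1 / 2) ^ (s ^ 2 + 6) : ℝ) = 1 / 4 := by
          rw [pow_add, one_div, inv_pow]
          field_simp
          norm_num
        rw [← this, mul_pow, mul_pow, mul_pow]
        ring
      _ ≤ 1 / 2 := by
        have := pow_le_pow_of_le_one (a := (1 / 4 : ℝ)) (by norm_num) (by norm_num) hk1
        linarith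
  have hfin : (2 * ((Finset.univ : Finset (Fin w → Fin q)).filter fun h =>
        ¬ EvenlyMarked (zeroMark h) s (D * k) l).card : ℝ) ≤ q ^ w := by
    have hqw : (0 : ℝ) ≤ (q : ℝ) ^ w := by positivity
    nlinarith
  exact_mod_cast hfin

/-- Double counting of bad pairs: if each word is bad for at most half of the markings, then some
marking is bad for at most half of the words. -/
theorem exists_mul_card_filter_le {α β : Type*} [Fintype β] [Nonempty β] (S : Finset α)
    (bad : α → β → Prop) [∀ a b, Decidable (bad a b)]
    (h : ∀ a ∈ S, 2 * (Finset.univ.filter fun b => bad a b).card ≤ Fintype.card β) :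
    ∃ b, 2 * (S.filter fun a => bad a b).card ≤ S.card := by
  obtain ⟨b, -, hb⟩ := Finset.exists_le_of_sum_le (s := (Finset.univ : Finset β))
    (f := fun b => 2 * (S.filter fun a => bad a b).card) (g := fun _ => S.card)
    Finset.univ_nonempty (by
      have := Finset.sum_card_bipartiteAbove_eq_sum_card_bipartiteBelow (s := S)
        (t := (Finset.univ : Finset β)) bad
      simp only [Finset.bipartiteAbove, Finset.bipartiteBelow] at this
      rw [← Finset.mul_sum, ← this, Finset.mul_sum]
      refine (Finset.sum_le_card_nsmul _ _ _ h).trans_eq ?_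
      simp [mul_comm])
  exact ⟨b, hb⟩

/-! ### Assembling the code -/

open Classical in
theorem exists_burst_code (s ρ : ℕ) (hρ : 1 ≤ ρ) :
    ∃ D : ℕ, ∀ n : ℕ, 2 ≤ n → ∀ (w : ℕ) (r : Fin w → ℕ), IsMultiplicityVector n r →
      (∀ a, r a ≤ ρ) →
      ∃ C : Finset (Fin n → Fin w), C.Nonempty ∧ IsBSDCodeLE s n r C ∧
        redundancy n r C ≤ Real.logb 2
          (2 * ((s * n + s ^ 2 + 1) * burstColors s (2 * (D * Nat.log 2 n + s)) ^ 2 : ℕ)) := by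
  obtain ⟨q, D, hq, hD, hbad⟩ := exists_two_mul_card_not_evenlyMarked_le s ρ hρ
  refine ⟨D, fun n hn w r hr hrρ => ?_⟩
  have : Nonempty (Fin w → Fin q) := ⟨fun _ => ⟨0, hq⟩⟩
  obtain ⟨h, hh⟩ := exists_mul_card_filter_le (multiPerms n r) (fun σ (h : Fin w → Fin q) =>
    ¬ EvenlyMarked (zeroMark h) s (D * Nat.log 2 n) (List.ofFn σ)) (fun σ hσ => by
      simpa using hbad n w (List.ofFn σ) hn (by simp) fun a => by
        rw [count_ofFn_of_mem_multiPerms hσ]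
        exact hrρ a)
  have hk1 : 1 ≤ Nat.log 2 n := Nat.log_pos (by norm_num) hn
  refine exists_code_of_marking hr (zeroMark h) (by nlinarith)
    ((multiPerms n r).filter fun σ =>
      EvenlyMarked (zeroMark h) s (D * Nat.log 2 n) (List.ofFn σ)) (Finset.filter_subset _ _) ?_
    fun σ hσ => (Finset.mem_filter.1 hσ).2
  have := Finset.card_filter_add_card_filter_not (s := multiPerms n r) fun σ =>
      EvenlyMarked (zeroMark h) s (D * Nat.log 2 n) (List.ofFn σ)
  omega

/-- The number of labels is at most a constant times `n * (log n) ^ 4`. -/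
theorem exists_logb_labels_le (s D : ℕ) : ∃ K : ℝ, ∀ n : ℕ, 2 ≤ n →
    Real.logb 2 (2 * ((s * n + s ^ 2 + 1) * burstColors s (2 * (D * Nat.log 2 n + s)) ^ 2 : ℕ)) ≤
      Real.logb 2 n + 4 * Real.logb 2 (Real.logb 2 n) + K := by
  set c : ℕ := 2 * (s + s ^ 2 + 1) *
    ((2 * (D + s) + 1) * ((2 * (D + s) + 1) * ((s + 1) * s.factorial)) + 1) ^ 2 with hc
  refine ⟨Real.logb 2 c, fun n hn => ?_⟩
  set k := Nat.log 2 n with hk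
  have hk1 : 1 ≤ k := Nat.log_pos (by norm_num) hn
  have hlen : 2 * (D * k + s) + 1 ≤ (2 * (D + s) + 1) * k := by nlinarith [Nat.zero_le s]
  have hcol : burstColors s (2 * (D * k + s)) ≤
      ((2 * (D + s) + 1) * ((2 * (D + s) + 1) * ((s + 1) * s.factorial)) + 1) * k ^ 2 := by
    have h1 : 1 ≤ k ^ 2 := Nat.one_le_pow _ _ hk1
    calc _ ≤ ((2 * (D + s) + 1) * k) * (((2 * (D + s) + 1) * k) * ((s + 1) * s.factorial)) + k ^ 2 := by
          rw [burstColors]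
          gcongr
      _ = _ := by ring
  have htot : 2 * ((s * n + s ^ 2 + 1) * burstColors s (2 * (D * k + s)) ^ 2) ≤ n * (k ^ 4 * c) := by
    have h1 : s * n + s ^ 2 + 1 ≤ (s + s ^ 2 + 1) * n := by nlinarith [Nat.zero_le (s ^ 2)]
    calc _ ≤ 2 * (((s + s ^ 2 + 1) * n) *
          (((2 * (D + s) + 1) * ((2 * (D + s) + 1) * ((s + 1) * s.factorial)) + 1) * k ^ 2) ^ 2) := by
          gcongr
      _ = _ := by rw [hc]; ring
  have hn0 : (0 : ℝ) < n := by positivity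
  have hk0 : (0 : ℝ) < k := by exact_mod_cast hk1
  have hc0 : (0 : ℝ) < c := by rw [hc]; positivity
  have hcol0 : 0 < burstColors s (2 * (D * k + s)) := Nat.succ_pos _
  have hkn : (k : ℝ) ≤ Real.logb 2 n := by
    have := Real.natLog_le_logb n 2
    exact_mod_cast this
  calc _ ≤ Real.logb 2 (n * ((k : ℝ) ^ 4 * c)) := by
        apply Real.logb_le_logb_of_le (by norm_num)
        · positivity
        · exact_mod_cast htot
    _ = Real.logb 2 n + 4 * Real.logb 2 k + Real.logb 2 c := by
        rw [Real.logb_mul hn0.ne' (by positivity), Real.logb_mul (by positivity) hc0.ne',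
          Real.logb_pow]
        push_cast
        ring
    _ ≤ _ := by
        have := Real.logb_le_logb_of_le (b := 2) (by norm_num) hk0 hkn
        linarith

/-- For every `s ≥ 1` there is a constant depending only on `s` and on the largest multiplicity
such that for every multiplicity vector `r`, regular or not, there is an `≤s`-BSD multi-permutation
code in `S_n^r` of redundancy at most `log n + (3s-2) log log n` plus that constant. -/
theorem mainTheorem7 (s : ℕ) (hs : 1 ≤ s) :
    ∃ K : ℕ → ℝ, ∀ (n : ℕ), 2 ≤ n → ∀ (w : ℕ) (r : Fin w → ℕ), IsMultiplicityVector n r →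
      ∃ C : Finset (Fin n → Fin w), C.Nonempty ∧ IsBSDCodeLE s n r C ∧
        redundancy n r C ≤
          Real.logb 2 (n : ℝ) + (3 * (s : ℝ) - 2) * Real.logb 2 (Real.logb 2 (n : ℝ)) +
            K (Finset.univ.sup r) := by
  have hloglog : ∀ n : ℕ, 2 ≤ n → 0 ≤ Real.logb 2 (Real.logb 2 (n : ℝ)) := by
    intro n hn
    have hn' : (2 : ℝ) ≤ n := by exact_mod_cast hn
    have h1 : (1 : ℝ) ≤ Real.logb 2 n := by
      rw [Real.le_logb_iff_rpow_le (by norm_num) (by positivity)]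
      simpa using hn'
    exact Real.logb_nonneg (by norm_num) h1
  -- The general construction costs `4 log log n`, which is within `3 * s - 2` only from `s = 2` on.
  rcases hs.eq_or_lt with rfl | hs2
  · refine ⟨fun _ => 2, fun n hn w r hr => ?_⟩
    obtain ⟨C, h1, h2, h3⟩ := exists_single_deletion_code hn hr
    refine ⟨C, h1, h2, h3.trans ?_⟩
    have := hloglog n hn
    push_cast
    linarith
  -- The shift to `ρ + 1` supplies the positivity of the bound, so `K` is defined at every argument.
  · choose D hD using fun ρ : ℕ => exists_burst_code s (ρ + 1) (by omega)
    choose K hK using fun ρ : ℕ => exists_logb_labels_le s (D ρ)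
    refine ⟨K, fun n hn w r hr => ?_⟩
    obtain ⟨C, h1, h2, h3⟩ := hD (Finset.univ.sup r) n hn w r hr fun a =>
      (Finset.le_sup (f := r) (Finset.mem_univ a)).trans (Nat.le_succ _)
    refine ⟨C, h1, h2, h3.trans ((hK _ n hn).trans ?_)⟩
    have hs' : (2 : ℝ) ≤ s := by exact_mod_cast hs2
    have := hloglog n hn
    nlinarith
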